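/- A left brace is a set $B$ with two operations $+$ and $\cdot$ such that $(B,+)$ is an abelian group, $(B,\cdot)$ is a group, and $a\cdot(b+c)+a=a\cdot b+a\cdot c$ for all $a,b,c\in B$. A finite group is called an $A$-group if all of its Sylow subgroups are abelian, and a group is called an involutive Yang--Baxter group (IYB group) if it is isomorphic to the multiplicative group $(B,\cdot)$ of some finite left brace $B$. Theorem. Every finite solvable $A$-group is an IYB group. -/

import Mathlib

universe u

/-- A left brace: a set with an abelian group structure `+` and a group structure `*`
such that `a * (b + c) + a = a * b + a * c`. -/
class LeftBrace (B : Type u) extends AddCommGroup B, Group B where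
  mul_add_add_self (a b c : B) : a * (b + c) + a = a * b + a * c

/-- All Sylow subgroups (for every prime) are abelian. -/
def IsAGroup (G : Type u) [Group G] : Prop :=
  ∀ (p : ℕ) [Fact p.Prime] (P : Sylow p G), IsMulCommutative P

/-- An involutive Yang-Baxter group: a group isomorphic to the multiplicative group of a finite
left brace. -/
def IsIYBGroup (G : Type u) [Group G] : Prop :=
  ∃ (B : Type u) (_ : LeftBrace B), Finite B ∧ Nonempty (G ≃* B)

open Subgroup

/-! A finite group is IYB exactly when it has a bijective 1-cocycle into an abelian group, and
cocycles extend across a split abelian normal subgroup. By induction on the order it is enough to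
split a nonabelian `G` over some abelian normal `N ≠ 1`. Take a term `M` of the derived series with
`M'` abelian and nontrivial, and let `N` be a Sylow subgroup of `M'`. Transfer shows that `N` meets
the centre of `M` trivially, and a Frattini argument then gives the complement. -/

/-- A bijective 1-cocycle into an abelian group makes a finite group an IYB group. -/
theorem IsIYBGroup.of_cocycle {G : Type u} [Group G] [Finite G] {A : Type u} [AddCommGroup A]
    (e : G ≃ A) (l : G → A →+ A) (he : ∀ g h, e (g * h) = e g + l g (e h)) : IsIYBGroup G := by
  let i : AddCommGroup G := e.addCommGroup
  have hadd (a b : G) : e (a + b) = e a + e b := e.apply_symm_apply _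
  refine ⟨G, { i, (inferInstance : Group G) with mul_add_add_self := fun a b c => ?_ },
    inferInstance, ⟨MulEquiv.refl G⟩⟩
  apply e.injective
  change e (a * (b + c) + a) = e (a * b + a * c)
  rw [hadd, hadd, he, he, he, hadd, map_add]
  abel

theorem IsIYBGroup.exists_cocycle {G : Type u} [Group G] (h : IsIYBGroup G) :
    ∃ (A : Type u) (_ : AddCommGroup A) (e : G ≃ A) (l : G → A →+ A),
      ∀ g h, e (g * h) = e g + l g (e h) := by
  obtain ⟨B, hB, -, ⟨f⟩⟩ := h
  have key (a b c : B) : a * (b + c) = a * b + a * c - a :=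
    eq_sub_of_add_eq (LeftBrace.mul_add_add_self a b c)
  refine ⟨B, inferInstance, f.toEquiv,
    fun g => AddMonoidHom.mk' (fun b => f g * b - f g) fun b c => ?_, fun g h => ?_⟩
  · change f g * (b + c) - f g = f g * b - f g + (f g * c - f g)
    rw [key]
    abel
  · change f (g * h) = f g + (f g * f h - f g)
    rw [map_mul]
    abel

theorem IsIYBGroup.of_comm {G : Type u} [Group G] [Finite G] (h : ∀ a b : G, a * b = b * a) :
    IsIYBGroup G := by
  let _ : CommGroup G := { (inferInstance : Group G) with mul_comm := h }
  exact .of_cocycle (A := Additive G) Additive.ofMul (fun _ => AddMonoidHom.id _) fun _ _ => rfl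

/-- A semidirect product of an abelian group by an IYB group is an IYB group. -/
theorem IsIYBGroup.of_isComplement' {G : Type u} [Group G] [Finite G] (N H : Subgroup G)
    [N.Normal] (hN : IsMulCommutative N) (hc : IsComplement' N H) (hH : IsIYBGroup H) :
    IsIYBGroup G := by
  obtain ⟨C, _, f, l, hl⟩ := hH.exists_cocycle
  let _ : CommGroup N := { (inferInstance : Group N) with mul_comm := hN.is_comm.comm }
  let d : N × H ≃ G := Equiv.ofBijective (fun x => (x.1 : G) * x.2) hc
  have hd (x : N × H) : d x = (x.1 : G) * x.2 := rfl
  let e : G ≃ Additive N × C := d.symm.trans (Equiv.prodCongr Additive.ofMul f)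
  -- Only the `H`-component needs to act: `N` is abelian, so it acts trivially on itself.
  refine .of_cocycle e (fun g => AddMonoidHom.prodMap
    (MonoidHom.toAdditive (MulAut.conjNormal ((d.symm g).2 : G)).toMonoidHom) (l (d.symm g).2))
    fun g h => ?_
  obtain ⟨⟨n, x⟩, rfl⟩ := d.surjective g
  obtain ⟨⟨m, y⟩, rfl⟩ := d.surjective h
  have hprod : d (n, x) * d (m, y) = d (n * MulAut.conjNormal (x : G) m, x * y) := by
    simp only [hd, Subgroup.coe_mul, MulAut.conjNormal_apply]
    group
  rw [hprod]
  simp only [e, Equiv.trans_apply, Equiv.symm_apply_apply]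
  exact Prod.ext rfl (hl x y)

/-- Two complements of an abelian normal subgroup of coprime order are conjugate by an element
of that subgroup. -/
theorem exists_conj_le_of_coprime {G : Type*} [Group G] [Finite G] (N : Subgroup G) [N.Normal]
    (hN : IsMulCommutative N) (K L : Subgroup G) (hL : N ⊓ L = ⊥) (hKL : K ≤ N ⊔ L)
    (hcop : (Nat.card N).Coprime (Nat.card K)) :
    ∃ n ∈ N, ∀ k ∈ K, n * k * n⁻¹ ∈ L := by
  let _ : CommGroup N := { (inferInstance : Group N) with mul_comm := hN.is_comm.comm }
  have hex (k : K) : ∃ c : N, (c : G) * k ∈ L := by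
    obtain ⟨a, ha, b, hb, hab⟩ := mem_sup_of_normal_left.1 (hKL k.2)
    exact ⟨⟨a, ha⟩⁻¹, by simpa [← hab] using hb⟩
  choose c hc using hex
  have hcoc (k l : K) : c (k * l) = c k * MulAut.conjNormal (k : G) (c l) := by
    have h1 : (c (k * l) : G) * (c k * ((k : G) * c l * (k : G)⁻¹))⁻¹ ∈ N ⊓ L := by
      refine ⟨N.mul_mem (c _).2 (N.inv_mem (N.mul_mem (c k).2
        (Normal.conj_mem inferInstance _ (c l).2 k))), ?_⟩
      have := L.mul_mem (hc (k * l)) (L.inv_mem (L.mul_mem (hc k) (hc l)))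
      change _ ∈ L
      convert this using 1
      simp only [Subgroup.coe_mul]
      group
    rw [hL, mem_bot, mul_inv_eq_one] at h1
    exact Subtype.ext h1
  let _ := Fintype.ofFinite K
  -- Averaging: `n` is the `|K|`-th root of the product of all values of `c`, and it makes `c` a
  -- coboundary.
  obtain ⟨n, hn⟩ := (powCoprime hcop).surjective (∏ l, c l)
  have hn' : n ^ Nat.card K = ∏ l, c l := hn
  have key (k : K) : c k = n * (MulAut.conjNormal (k : G) n)⁻¹ := by
    apply (powCoprime hcop).injective
    change c k ^ Nat.card K = (n * (MulAut.conjNormal (k : G) n)⁻¹) ^ Nat.card K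
    rw [mul_pow, inv_pow, ← map_pow, hn', eq_mul_inv_iff_mul_eq, map_prod]
    calc _ = ∏ l, c (k * l) := by
          simp_rw [hcoc, Finset.prod_mul_distrib]
          simp [Nat.card_eq_fintype_card]
      _ = _ := Fintype.prod_equiv (Equiv.mulLeft k) _ _ fun _ => rfl
  refine ⟨n, n.2, fun k hk => ?_⟩
  have := hc ⟨k, hk⟩
  rw [key] at this
  simpa [MulAut.conjNormal_apply, mul_assoc] using this

/-- If `N ≤ X` are normal subgroups, `N` is an abelian Hall subgroup of `X`, and only the
identity of `N` centralizes `X`, then `N` has a complement in the whole group. -/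
theorem exists_isComplement'_of_coprime_relIndex {G : Type*} [Group G] [Finite G]
    (N X : Subgroup G) [N.Normal] [X.Normal] (hN : IsMulCommutative N) (hNX : N ≤ X)
    (hcop : (Nat.card N).Coprime (N.relIndex X))
    (hcent : ∀ z ∈ N, (∀ x ∈ X, x * z = z * x) → z = 1) :
    ∃ H : Subgroup G, IsComplement' N H := by
  obtain ⟨K', hK'⟩ := exists_right_complement'_of_coprime (N := N.subgroupOf X)
    (by rwa [Nat.card_congr (subgroupOfEquivOfLe hNX).toEquiv])
  let K := K'.map X.subtype
  have hKX : K ≤ X := map_subtype_le K'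
  have hsup : N ⊔ K = X := by
    have := congrArg (map X.subtype) hK'.sup_eq_top
    rwa [Subgroup.map_sup, map_subgroupOf_eq_of_le hNX, ← MonoidHom.range_eq_map, range_subtype] at this
  have hinf : N ⊓ K = ⊥ := by
    have := congrArg (map X.subtype) hK'.disjoint.eq_bot
    rwa [Subgroup.map_inf _ _ _ X.subtype_injective, map_subgroupOf_eq_of_le hNX, Subgroup.map_bot] at this
  have hcard : Nat.card K = N.relIndex X := by
    rw [card_map_of_injective X.subtype_injective]
    exact hK'.symm.index_eq_card.symm
  -- An element of `N` normalizing `K` commutes with `K` modulo `N ⊓ K = ⊥`, so it centralizes `X =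
  -- NK`. Conjugates of `K` are already conjugate under `N`, so `N` and the normalizer generate `G`.
  refine ⟨normalizer K, isComplement'_of_disjoint_and_mul_eq_univ ?_ ?_⟩
  · rw [disjoint_iff, eq_bot_iff]
    rintro z ⟨hz, hzK⟩
    have hcK (k : G) (hk : k ∈ K) : k * z = z * k := by
      have h1 : z * k * z⁻¹ * k⁻¹ ∈ N ⊓ K := by
        refine ⟨?_, K.mul_mem ((mem_normalizer_iff.1 hzK k).1 hk) (K.inv_mem hk)⟩
        rw [mul_assoc, mul_assoc, ← mul_assoc k]
        exact N.mul_mem hz (Normal.conj_mem inferInstance _ (N.inv_mem hz) k)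
      rw [hinf, mem_bot, mul_inv_eq_one, mul_inv_eq_iff_eq_mul] at h1
      exact h1.symm
    refine hcent z hz fun x hx => ?_
    rw [← hsup] at hx
    obtain ⟨n, hn, k, hk, rfl⟩ := mem_sup_of_normal_left.1 hx
    have hnz : n * z = z * n := congrArg Subtype.val (hN.is_comm.comm ⟨n, hn⟩ ⟨z, hz⟩)
    rw [mul_assoc, hcK k hk, ← mul_assoc, hnz, mul_assoc]
  · refine Set.eq_univ_of_forall fun g => ?_
    have hconj : ∀ k ∈ K, g * k * g⁻¹ ∈ X := fun k hk =>
      Normal.conj_mem inferInstance k (hKX hk) g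
    obtain ⟨n, hn, h⟩ := exists_conj_le_of_coprime N hN (K.map (MulAut.conj g).toMonoidHom) K hinf
      (by
        rw [hsup]
        rintro _ ⟨k, hk, rfl⟩
        exact hconj k hk)
      (by rwa [card_map_of_injective (MulAut.conj g).injective, hcard])
    refine ⟨n⁻¹, N.inv_mem hn, n * g, ?_, by simp⟩
    have hle : K.map (MulAut.conj (n * g)).toMonoidHom ≤ K := by
      rintro _ ⟨k, hk, rfl⟩
      have := h _ ⟨k, hk, rfl⟩
      simpa [mul_assoc] using this
    have heq := eq_of_le_of_card_ge hle
      (card_map_of_injective (MulAut.conj (n * g)).injective).ge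
    refine mem_normalizer_iff.2 fun k => ⟨fun hk => hle ⟨k, hk, rfl⟩, fun hk => ?_⟩
    rw [← heq] at hk
    obtain ⟨k', hk', hkk⟩ := hk
    exact (MulAut.conj (n * g)).injective hkk ▸ hk'

theorem IsAGroup.subgroup {G : Type u} [Group G] (hG : IsAGroup G) (H : Subgroup G) :
    IsAGroup H := by
  intro p _ P
  obtain ⟨Q, hQ⟩ := P.exists_comap_subtype_eq
  have := hG p Q
  have hmem (a : P) : ((a : H) : G) ∈ Q := by
    have h := a.2
    change (a : H) ∈ (P : Subgroup H) at h
    rwa [← hQ] at h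
  refine ⟨⟨fun a b => P.1.subtype_injective (H.subtype_injective ?_)⟩⟩
  change ((a : H) : G) * (b : H) = (b : H) * (a : H)
  exact congrArg Subtype.val (this.is_comm.comm ⟨_, hmem a⟩ ⟨_, hmem b⟩)

open scoped IsMulCommutative in
/-- If a Sylow `p`-subgroup is abelian, a central `p`-element of the derived subgroup is
trivial. -/
theorem eq_one_of_mem_commutator_of_mem_center {M : Type*} [Group M] [Finite M] {p : ℕ}
    [Fact p.Prime] (P : Sylow p M) [IsMulCommutative P] {z : M} (hzP : z ∈ P)
    (hz : z ∈ commutator M) (hzc : z ∈ center M) : z = 1 := by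
  -- On central elements the transfer into `P` is the power by the index; on commutators it is
  -- trivial.
  have h1 := MonoidHom.transfer_eq_pow (MonoidHom.id P) z fun k g _ => by
    have := mem_center_iff.1 ((center M).pow_mem hzc k) g
    rw [mul_assoc, ← this, inv_mul_cancel_left]
  have h2 : MonoidHom.transfer (MonoidHom.id P) z = 1 :=
    Abelianization.commutator_subset_ker _ hz
  rw [h2] at h1
  have h3 : z ^ (P : Subgroup M).index = 1 := (congrArg Subtype.val h1).symm
  obtain ⟨k, hk⟩ := P.2 ⟨z, hzP⟩
  have h4 : z ^ p ^ k = 1 := congrArg Subtype.val hk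
  have hc : (P : Subgroup M).index.Coprime (p ^ k) :=
    (((Fact.out : p.Prime).coprime_iff_not_dvd.2 P.not_dvd_index).symm).pow_right k
  exact orderOf_eq_one_iff.1
    (Nat.eq_one_of_dvd_coprimes hc (orderOf_dvd_of_pow_eq_one h3) (orderOf_dvd_of_pow_eq_one h4))

/-- In a finite `A`-group with abelian derived subgroup, the Sylow `p`-subgroup `N` of the derived
subgroup is a Hall subgroup, with no central elements, of a characteristic subgroup `X`. -/
theorem IsAGroup.exists_characteristic {M : Type u} [Group M] [Finite M] (hM : IsAGroup M)
    (hc : IsMulCommutative (commutator M)) (p : ℕ) [Fact p.Prime]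
    (hp : p ∣ Nat.card (commutator M)) :
    ∃ N X : Subgroup M, N.Characteristic ∧ X.Characteristic ∧ N ≠ ⊥ ∧ IsMulCommutative N ∧
      N ≤ X ∧ (Nat.card N).Coprime (N.relIndex X) ∧
      ∀ z ∈ N, (∀ x ∈ X, x * z = z * x) → z = 1 := by
  have hpp : p.Prime := Fact.out
  let S : Sylow p (commutator M) := default
  have hSn : (S : Subgroup (commutator M)).Normal :=
    ⟨fun a ha b => by rwa [hc.is_comm.comm b a, mul_inv_cancel_right]⟩
  have hSc : (S : Subgroup (commutator M)).Characteristic := S.characteristic_of_normal hSn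
  let N : Subgroup M := (S : Subgroup (commutator M)).map (commutator M).subtype
  have hNA : N ≤ commutator M := map_subtype_le _
  have hNp : IsPGroup p N := S.2.map _
  have hNc : N.Characteristic := characteristic_of_characteristic_of_characteristic
  -- With `m` the `p'`-part of `|M/M'|`, the subgroup `X/M'` is the `m`-torsion, of order prime to
  -- `p`, and `M/X` is a `p`-group.
  obtain ⟨a, m, hm, hcard⟩ := Nat.exists_eq_pow_mul_and_not_dvd
    (Nat.card_pos (α := Abelianization M)).ne' p hpp.ne_one
  let f : M →* Abelianization M := (powMonoidHom m).comp Abelianization.of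
  let X := f.ker
  have hAX : commutator M ≤ X := Abelianization.commutator_subset_ker f
  have hindex : ∃ k, X.index = p ^ k := by
    rw [index_ker]
    refine IsPGroup.iff_card.1 ?_
    rintro ⟨_, x, rfl⟩
    refine ⟨a, Subtype.ext ?_⟩
    change ((Abelianization.of x) ^ m) ^ p ^ a = 1
    rw [← pow_mul, mul_comm, ← hcard, pow_card_eq_one']
  have hAXp : ¬ p ∣ (commutator M).relIndex X := by
    rw [← Abelianization.ker_of, relIndex_ker]
    intro h
    obtain ⟨⟨_, x, hx, rfl⟩, ho⟩ := exists_prime_orderOf_dvd_card' p h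
    refine hm (ho ▸ orderOf_dvd_of_pow_eq_one (Subtype.ext ?_))
    exact hx
  have hNAp : ¬ p ∣ N.relIndex (commutator M) := by
    have : N.subgroupOf (commutator M) = S := 
      comap_map_eq_self_of_injective (commutator M).subtype_injective _
    rw [relIndex, this]
    exact S.not_dvd_index
  refine ⟨N, X, hNc, ?_, ?_, ?_, hNA.trans hAX, ?_, ?_⟩
  · refine characteristic_iff_comap_le.2 fun φ x hx => ?_
    have h : Abelianization.of (φ x) ^ m = 1 := hx
    rw [← map_pow, ← map_pow, ← MonoidHom.mem_ker, Abelianization.ker_of] at h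
    change Abelianization.of x ^ m = 1
    rw [← map_pow, ← MonoidHom.mem_ker, Abelianization.ker_of]
    have : (commutator M).comap φ.toMonoidHom = commutator M :=
      characteristic_iff_comap_eq.1 inferInstance φ
    exact this ▸ h
  · intro h
    have h1 : Nat.card N = Nat.card S := card_map_of_injective (commutator M).subtype_injective
    rw [h, card_bot] at h1
    have hS := S.card_mul_index
    rw [← h1, one_mul] at hS
    exact S.not_dvd_index (hS ▸ hp)
  · infer_instance
  · obtain ⟨k, hk⟩ := IsPGroup.iff_card.1 hNp
    rw [hk, ← relIndex_mul_relIndex _ _ _ hNA hAX]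
    exact .pow_left k ((hpp.coprime_iff_not_dvd).2 (hpp.not_dvd_mul hNAp hAXp))
  · intro z hz hzX
    obtain ⟨P, hP⟩ := hNp.exists_le_sylow
    have hPc := hM p P
    refine eq_one_of_mem_commutator_of_mem_center P (hP hz) (hNA hz) ?_
    have hXc : X ≤ centralizer {z} := fun x hx => mem_centralizer_singleton_iff.2 (hzX x hx)
    have hPz : (P : Subgroup M) ≤ centralizer {z} := fun x hx => mem_centralizer_singleton_iff.2
      (congrArg Subtype.val (hPc.is_comm.comm ⟨x, hx⟩ ⟨z, hP hz⟩))
    obtain ⟨k, hk⟩ := hindex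
    -- The index divides both a power of `p` (from `X`) and a number prime to `p` (from `P`).
    have htop : centralizer {z} = (⊤ : Subgroup M) := index_eq_one.1 <|
      Nat.eq_one_of_dvd_coprimes
        ((((hpp.coprime_iff_not_dvd).2 P.not_dvd_index).pow_left k).symm)
        (index_dvd_of_le hPz) (hk ▸ index_dvd_of_le hXc)
    exact mem_center_iff.2 fun g => mem_centralizer_singleton_iff.1 (htop ▸ mem_top g)

/-- A nonabelian finite solvable `A`-group splits over a nontrivial abelian normal subgroup. -/
theorem IsAGroup.exists_isComplement' {G : Type u} [Group G] [Finite G] [Group.IsSolvable G]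
    (hG : IsAGroup G) (hnc : commutator G ≠ ⊥) :
    ∃ N H : Subgroup G, N.Normal ∧ N ≠ ⊥ ∧ IsMulCommutative N ∧ IsComplement' N H := by
  classical
  have hs : ∃ n, derivedSeries G n = ⊥ := Group.IsSolvable.solvable
  -- The derived length is at least 2 because `G` is nonabelian.
  obtain ⟨n, hn⟩ : ∃ n, Nat.find hs = n + 2 := by
    refine Nat.exists_eq_add_of_le' ?_
    by_contra! h
    refine hnc (eq_bot_iff.2 ?_)
    rw [← Nat.find_spec hs, ← derivedSeries_one]
    exact derivedSeries_antitone G (by omega)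
  let M := derivedSeries G n
  have hmap : (commutator M).map M.subtype = derivedSeries G (n + 1) := map_subtype_commutator _
  have hA : derivedSeries G (n + 1) ≠ ⊥ := Nat.find_min hs (by omega)
  have hA2 : derivedSeries G (n + 2) = ⊥ := hn ▸ Nat.find_spec hs
  have hc : IsMulCommutative (commutator M) := by
    refine ⟨⟨fun a b => (commutator M).subtype_injective (M.subtype_injective ?_)⟩⟩
    have hmem (a : commutator M) : ((a : M) : G) ∈ derivedSeries G (n + 1) :=
      hmap ▸ mem_map_of_mem M.subtype a.2
    refine commutatorElement_eq_one_iff_mul_comm.1 (mem_bot.1 ?_)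
    rw [← hA2]
    exact commutator_mem_commutator (hmem a) (hmem b)
  have hne : Nat.card (commutator M) ≠ 1 := fun h => by
    rw [card_eq_one.1 h, Subgroup.map_bot] at hmap
    exact hA hmap.symm
  obtain ⟨p, hp, hpd⟩ := Nat.exists_prime_and_dvd hne
  have : Fact p.Prime := ⟨hp⟩
  obtain ⟨N, X, _, _, hN1, hNc, hNX, hcop, hcent⟩ :=
    (hG.subgroup M).exists_characteristic hc p hpd
  have hNn : (N.map M.subtype).Normal := ConjAct.normal_of_characteristic_of_normal
  have hXn : (X.map M.subtype).Normal := ConjAct.normal_of_characteristic_of_normal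
  obtain ⟨H, hH⟩ := exists_isComplement'_of_coprime_relIndex (N.map M.subtype) (X.map M.subtype)
    inferInstance (map_mono hNX)
    (by rwa [relIndex_map_map_of_injective _ _ M.subtype_injective,
      card_map_of_injective M.subtype_injective])
    (by
      rintro _ ⟨z, hz, rfl⟩ h
      rw [hcent z hz fun x hx => M.subtype_injective (by simpa using h _ ⟨x, hx, rfl⟩), map_one])
  exact ⟨_, H, hNn, by rwa [Ne, map_eq_bot_iff_of_injective _ M.subtype_injective],
    inferInstance, hH⟩

theorem IsAGroup.isIYBGroup_of_card_eq (n : ℕ) : ∀ (G : Type u) [Group G] [Finite G]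
    [Group.IsSolvable G], IsAGroup G → Nat.card G = n → IsIYBGroup G := by
  induction n using Nat.strong_induction_on with
  | _ n ih =>
    intro G _ _ _ hG hn
    by_cases hnc : commutator G = ⊥
    · exact .of_comm fun a b => commutatorElement_eq_one_iff_mul_comm.1 <| mem_bot.1 <|
        hnc ▸ commutator_mem_commutator (mem_top a) (mem_top b)
    · obtain ⟨N, H, _, hN, hNc, hc⟩ := hG.exists_isComplement' hnc
      refine .of_isComplement' N H hNc hc (ih (Nat.card H) ?_ H (hG.subgroup H) rfl)
      rw [← hn, ← hc.card_mul_card]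
      have : 1 < Nat.card N := (one_lt_card_iff_ne_bot N).2 hN
      exact lt_mul_of_one_lt_left Nat.card_pos this

theorem mainTheorem5 (G : Type u) [Group G] [Finite G] [Group.IsSolvable G] (hG : IsAGroup G) :
    IsIYBGroup G :=
  hG.isIYBGroup_of_card_eq _ G rfl
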